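/- Let $\mathbb{TP}^n=\mathbb{R}^{n+1}/\mathbb{R}(1,\dots,1)$ and let $L\subset\mathbb{TP}^n$ be a $d$-dimensional linear subspace. Let $M$ be a real $d\times(n+1)$ matrix whose rows represent a basis of $L$, and let $V_L=(v_0,\dots,v_n)$ be the configuration of points of $\mathbb{R}^d$ given by the columns of $M$. Assume that $L$ is generic: no $d+1$ of the points $v_i$ (counted with their labels) lie in an affine subspace of dimension $d-1$. The first tropical secant variety of $L$ is $$S^1(L)=\{\,[\min(y^1,y^2)] : y^1,y^2\in\mathbb{R}^{n+1},\ [y^1],[y^2]\in L\,\}\subset\mathbb{TP}^n,$$ where the minimum is taken coordinatewise. For a height vector $x\in\mathbb{R}^{n+1}$, a facet is a label set $F=\{i: f(v_i)=x_i\}$, where $f$ is an affine functional on $\mathbb{R}^d$ with $f(v_i)\ge x_i$ for all $i$ and the points $v_i$, $i\in F$, affinely span $\mathbb{R}^d$. The regular subdivision $\Sigma_x$ induced by $x$ is the set of its facets. A subdivision refines another if each of its facets is contained in a facet of the other. Call $\Sigma_x$ valid if it has two (possibly equal) facets whose union contains all labels. The cell of $\Sigma_x$ is the set $C(\Sigma_x)\subset\mathbb{TP}^n$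 of the classes of all $y\in\mathbb{R}^{n+1}$ such that $\Sigma_x$ refines $\Sigma_y$. Then the first tropical secant variety of $L$ is a pure complex: the cells of the valid regular subdivisions form a finite polyhedral complex whose union is $S^1(L)$, and every cell is contained in a cell of maximal dimension among all the cells. That is, for every valid regular subdivision $\Sigma_x$ there is a valid regular subdivision $\Sigma_z$ that refines $\Sigma_x$ and whose cell has the maximal dimension. -/

import Mathlib

namespace TropSecant

/-- Tropical projective space `ℝⁿ⁺¹ / ℝ(1,…,1)`. -/
abbrev TP (n : ℕ) : Type :=
  (Fin (n + 1) → ℝ) ⧸ Submodule.span ℝ {(1 : Fin (n + 1) → ℝ)}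

/-- The class in tropical projective space of a vector of `ℝⁿ⁺¹`. -/
abbrev proj (n : ℕ) : (Fin (n + 1) → ℝ) →ₗ[ℝ] TP n :=
  (Submodule.span ℝ {(1 : Fin (n + 1) → ℝ)}).mkQ

/-- The tropical sum (coordinatewise minimum) of `k + 1` vectors. -/
def tropSum {n k : ℕ} (y : Fin (k + 1) → Fin (n + 1) → ℝ) : Fin (n + 1) → ℝ :=
  fun i => Finset.univ.inf' Finset.univ_nonempty (fun j => y j i)

/-- The `k`-th tropical secant variety of a linear subspace `L` of tropical projective space:
the classes of all tropical sums of `k + 1` vectors whose classes lie in `L`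
(equivalently, of `k + 1` elements of the preimage `L + ℝ(1,…,1)` of `L` in `ℝⁿ⁺¹`). -/
def secantVariety {n : ℕ} (k : ℕ) (L : Submodule ℝ (TP n)) : Set (TP n) :=
  {p | ∃ y : Fin (k + 1) → Fin (n + 1) → ℝ, (∀ j, proj n (y j) ∈ L) ∧ p = proj n (tropSum y)}

/-- `M` is an associated matrix of `L`: its `d` rows represent a basis of `L`.
In particular `L` has dimension `d`. -/
def IsAssociatedMatrix {n d : ℕ} (M : Matrix (Fin d) (Fin (n + 1)) ℝ)
    (L : Submodule ℝ (TP n)) : Prop :=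
  LinearIndependent ℝ (fun r => proj n (M r)) ∧
    Submodule.span ℝ (Set.range fun r => proj n (M r)) = L

/-- The point configuration in `ℝᵈ` given by the columns of `M`. -/
def pointConfig {n d : ℕ} (M : Matrix (Fin d) (Fin (n + 1)) ℝ) (i : Fin (n + 1)) : Fin d → ℝ :=
  fun r => M r i

/-- General position in `ℝᵈ`: no `d + 1` of the points lie in an affine subspace of
dimension `d - 1`. -/
def InGeneralPosition {n d : ℕ} (v : Fin (n + 1) → Fin d → ℝ) : Prop :=
  ∀ s : Finset (Fin (n + 1)), s.card = d + 1 → AffineIndependent ℝ (fun i : s => v i)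

/-- `F` is (the set of labels of the lifted points on) a facet of the upper envelope of the convex
hull of the lifted points `(v i, x i)`: a supporting non-vertical hyperplane, the graph of an
affine functional `f`, lies weakly above all the lifted points and contains exactly those with
label in `F`, and the points with label in `F` span `ℝᵈ` affinely. -/
def IsUpperFacet {n d : ℕ} (v : Fin (n + 1) → Fin d → ℝ) (x : Fin (n + 1) → ℝ)
    (F : Set (Fin (n + 1))) : Prop :=
  affineSpan ℝ (v '' F) = ⊤ ∧
    ∃ f : (Fin d → ℝ) →ᵃ[ℝ] ℝ, (∀ i, x i ≤ f (v i)) ∧ F = {i | x i = f (v i)}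

/-- The regular subdivision of the configuration `v` induced by the height vector `x`, as the
collection of its facets. -/
def regularSubdivision {n d : ℕ} (v : Fin (n + 1) → Fin d → ℝ) (x : Fin (n + 1) → ℝ) :
    Set (Set (Fin (n + 1))) :=
  {F | IsUpperFacet v x F}

/-- The subdivision `S` refines the subdivision `T`. -/
def Refines {n : ℕ} (S T : Set (Set (Fin (n + 1)))) : Prop :=
  ∀ F ∈ S, ∃ G ∈ T, F ⊆ G

/-- There are `k + 1` facets (repetitions allowed) whose union contains all of the points. -/
def CoveredByFacets {n : ℕ} (k : ℕ) (S : Set (Set (Fin (n + 1)))) : Prop :=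
  ∃ F : Fin (k + 1) → Set (Fin (n + 1)), (∀ j, F j ∈ S) ∧ ⋃ j, F j = Set.univ

/-- The closed cell of a subdivision `S` in tropical projective space: the classes of the height
vectors whose regular subdivision is `S` or a coarsening of `S`. -/
def cell {n d : ℕ} (v : Fin (n + 1) → Fin d → ℝ) (S : Set (Set (Fin (n + 1)))) : Set (TP n) :=
  proj n '' {y | Refines S (regularSubdivision v y)}

/-- The cells of the `k`-th tropical secant variety: the cells of those regular subdivisions in
which some `k + 1` facets contain all of the points. -/
def secantCells {n d : ℕ} (k : ℕ) (v : Fin (n + 1) → Fin d → ℝ) : Set (Set (TP n)) :=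
  {C | ∃ x, CoveredByFacets k (regularSubdivision v x) ∧ C = cell v (regularSubdivision v x)}

section Polyhedral

variable {E : Type*} [AddCommGroup E] [Module ℝ E]

/-- A polyhedron: the solution set of finitely many weak linear inequalities. -/
def IsPolyhedron (C : Set E) : Prop :=
  ∃ s : Finset (Module.Dual ℝ E × ℝ), C = {p | ∀ c ∈ s, c.1 p ≤ c.2}

/-- `F` is the face of `C` on which some linear functional attains its maximum over `C`
(all of `C` for the zero functional). -/
def IsFace (C F : Set E) : Prop :=
  ∃ l : Module.Dual ℝ E, F = {p ∈ C | ∀ q ∈ C, l q ≤ l p}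

/-- A finite polyhedral complex. -/
structure IsPolyhedralComplex (K : Set (Set E)) : Prop where
  finite : K.Finite
  isPolyhedron : ∀ C ∈ K, IsPolyhedron C
  nonempty : ∀ C ∈ K, C.Nonempty
  face_mem : ∀ C ∈ K, ∀ F, IsFace C F → F.Nonempty → F ∈ K
  inter_isFace : ∀ C ∈ K, ∀ D ∈ K, (C ∩ D).Nonempty → IsFace C (C ∩ D)

/-- The dimension of a cell, i.e. of its affine span. -/
noncomputable def cellDim (C : Set E) : ℕ := Module.finrank ℝ (vectorSpan ℝ C)

/-- Purity: every cell is contained in a cell of the maximal dimension. -/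
def IsPure (K : Set (Set E)) : Prop :=
  ∀ C ∈ K, ∃ D ∈ K, C ⊆ D ∧ ∀ B ∈ K, cellDim B ≤ cellDim D

end Polyhedral

end TropSecant

namespace TropSecant

/-! The vectors whose class lies in `L` are exactly the evaluations of affine functionals at the
points `v i`, so a point of the secant variety is the minimum of two affine functionals on the
configuration. Each of them lies weakly above the minimum and can be tilted, keeping its tight
labels, until it spans a facet (`exists_facet_of_le`); this identifies the points of the variety
with the valid subdivisions.

Polyhedral complex: the hyperplane through the lifted points of a spanning label set depends
linearly on the heights, so a cell is a cone cut out by slack functionals. Inside a cell, the cell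
of a coarser subdivision is the locus where the slacks tight there vanish (`refines_iff_tight`);
this rests on the facets covering the convex hull. Hence faces and intersections of cells are again
cells.

Purity: on a valid cell the heights are given by one functional on a label set `A` and by another
off `A`, so they lie in the range of `splitEval v A`, of rank at most `min (n + 1) (2 * (d + 1))`.
By genericity this rank is attained when `A` is balanced: `A` and its complement both have at least,
or both have at most, `d + 1` elements. Near any valid `x` there is such a balanced split with the
two functionals distinct at every point (`exists_balanced_splitEval`), and a generic height vector
nearby has a cell spanning the whole range (`exists_cell_span`). Subdivisions of nearby heights
refine that of `x`. For `d = 0` all points coincide and every valid cell is a point. -/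

variable {n d : ℕ}

/-! ### Affine functionals on a configuration, and general position -/

theorem exists_affineMap_ne_zero_of_affineSpan_ne_top {s : Set (Fin d → ℝ)}
    (hs : affineSpan ℝ s ≠ ⊤) : ∃ a : (Fin d → ℝ) →ᵃ[ℝ] ℝ, a ≠ 0 ∧ ∀ p ∈ s, a p = 0 := by
  rcases s.eq_empty_or_nonempty with rfl | ⟨q, hq⟩
  · refine ⟨AffineMap.const ℝ _ 1, fun h => ?_, by simp⟩
    simpa using congrArg (fun a : (Fin d → ℝ) →ᵃ[ℝ] ℝ => a 0) h
  · have hne : vectorSpan ℝ s < ⊤ := lt_top_iff_ne_top.2 fun h =>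
      hs ((AffineSubspace.affineSpan_eq_top_iff_vectorSpan_eq_top_of_nonempty ℝ _ _ ⟨q, hq⟩).2 h)
    obtain ⟨f, hf, hker⟩ := Submodule.exists_le_ker_of_lt_top _ hne
    refine ⟨f.toAffineMap + AffineMap.const ℝ _ (-f q), fun h => hf ?_, fun p hp => ?_⟩
    · have := congrArg AffineMap.linear h
      simpa using this
    · have : f (p - q) = 0 := hker (vsub_mem_vectorSpan ℝ hp hq)
      simp only [map_sub] at this
      simp only [AffineMap.coe_add, Pi.add_apply, LinearMap.coe_toAffineMap, AffineMap.const_apply]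
      linarith

/-- Evaluation of affine functionals on the points of a configuration. -/
def evalConfig (v : Fin (n + 1) → Fin d → ℝ) :
    ((Fin d → ℝ) →ᵃ[ℝ] ℝ) →ₗ[ℝ] (Fin (n + 1) → ℝ) where
  toFun f i := f (v i)
  map_add' _ _ := rfl
  map_smul' _ _ := rfl

@[simp]
theorem evalConfig_apply (v : Fin (n + 1) → Fin d → ℝ) (f : (Fin d → ℝ) →ᵃ[ℝ] ℝ) (i : Fin (n + 1)) :
    evalConfig v f i = f (v i) := rfl

theorem affineMap_ext_of_span {v : Fin (n + 1) → Fin d → ℝ} {G : Set (Fin (n + 1))}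
    (hG : affineSpan ℝ (v '' G) = ⊤) {f g : (Fin d → ℝ) →ᵃ[ℝ] ℝ}
    (h : ∀ i ∈ G, f (v i) = g (v i)) : f = g := by
  refine AffineMap.ext_on hG ?_
  rintro _ ⟨i, hi, rfl⟩
  exact h i hi

theorem span_mono {v : Fin (n + 1) → Fin d → ℝ} {G H : Set (Fin (n + 1))}
    (hG : affineSpan ℝ (v '' G) = ⊤) (h : G ⊆ H) : affineSpan ℝ (v '' H) = ⊤ :=
  top_le_iff.1 (hG ▸ affineSpan_mono ℝ (Set.image_mono h))

theorem span_nonempty {v : Fin (n + 1) → Fin d → ℝ} {G : Set (Fin (n + 1))}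
    (hG : affineSpan ℝ (v '' G) = ⊤) : G.Nonempty := by
  rw [Set.nonempty_iff_ne_empty]
  rintro rfl
  simp at hG

theorem affineMap_pointConfig (M : Matrix (Fin d) (Fin (n + 1)) ℝ) (f : (Fin d → ℝ) →ᵃ[ℝ] ℝ) :
    evalConfig (pointConfig M) f =
      ∑ r, f.linear (Pi.single r 1) • M r + f 0 • (1 : Fin (n + 1) → ℝ) := by
  ext i
  have h1 : f (pointConfig M i) = f.linear (pointConfig M i) + f 0 := by
    conv_lhs => rw [f.decomp]
    simp
  rw [evalConfig_apply, h1, LinearMap.pi_apply_eq_sum_univ f.linear]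
  simp only [pointConfig, smul_eq_mul, Pi.add_apply, Finset.sum_apply, Pi.smul_apply, Pi.one_apply,
    mul_one]
  congr 1
  refine Finset.sum_congr rfl fun r _ => ?_
  rw [mul_comm]
  congr 2
  ext j
  simp [Pi.single_apply, eq_comm]

theorem proj_one : proj n (1 : Fin (n + 1) → ℝ) = 0 := by
  simp [proj, Submodule.mem_span_singleton_self]

theorem proj_evalConfig_mem {L : Submodule ℝ (TP n)} {M : Matrix (Fin d) (Fin (n + 1)) ℝ}
    (hM : IsAssociatedMatrix M L) (f : (Fin d → ℝ) →ᵃ[ℝ] ℝ) :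
    proj n (evalConfig (pointConfig M) f) ∈ L := by
  rw [affineMap_pointConfig, map_add, map_smul, proj_one, smul_zero, add_zero, map_sum, ← hM.2]
  refine Submodule.sum_mem _ fun r _ => ?_
  rw [map_smul]
  exact Submodule.smul_mem _ _ (Submodule.subset_span ⟨r, rfl⟩)

/-- With `proj_evalConfig_mem`, this is the dictionary between `L` and affine functionals: the rows
of `M` are the coordinate functions on the points, and the line divided out supplies the constants.
-/
theorem exists_evalConfig_eq {L : Submodule ℝ (TP n)} {M : Matrix (Fin d) (Fin (n + 1)) ℝ}
    (hM : IsAssociatedMatrix M L) {y : Fin (n + 1) → ℝ} (hy : proj n y ∈ L) :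
    ∃ f, evalConfig (pointConfig M) f = y := by
  rw [← hM.2, Submodule.mem_span_range_iff_exists_fun] at hy
  obtain ⟨c, hc⟩ := hy
  have : proj n (y - ∑ r, c r • M r) = 0 := by
    rw [map_sub, map_sum, ← hc, sub_eq_zero]
    simp only [map_smul]
  rw [Submodule.mkQ_apply, Submodule.Quotient.mk_eq_zero, Submodule.mem_span_singleton] at this
  obtain ⟨b, hb⟩ := this
  refine ⟨(∑ r, c r • LinearMap.proj r : (Fin d → ℝ) →ₗ[ℝ] ℝ).toAffineMap + AffineMap.const ℝ _ b, ?_⟩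
  rw [sub_eq_iff_eq_add.1 hb.symm]
  ext i
  simp [pointConfig, add_comm]

/-- A hyperplane through all columns would be a linear relation between the rows and `1`.
Independence of the rows modulo `1` kills its linear part, and then its constant. -/
theorem affineSpan_pointConfig {L : Submodule ℝ (TP n)} {M : Matrix (Fin d) (Fin (n + 1)) ℝ}
    (hM : IsAssociatedMatrix M L) : affineSpan ℝ (pointConfig M '' Set.univ) = ⊤ := by
  by_contra h
  obtain ⟨a, ha, h0⟩ := exists_affineMap_ne_zero_of_affineSpan_ne_top h
  have hz : evalConfig (pointConfig M) a = 0 := by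
    ext i
    exact h0 _ ⟨i, trivial, rfl⟩
  have he := affineMap_pointConfig M a
  have hp := congrArg (proj n) he
  rw [hz, map_add, map_smul, proj_one, smul_zero, add_zero, map_sum, map_zero] at hp
  have hl := Fintype.linearIndependent_iff.1 hM.1 (fun r => a.linear (Pi.single r 1))
    (by simpa using hp.symm)
  have hlin : a.linear = 0 := by
    apply LinearMap.pi_ext'
    intro r
    ext
    simpa using hl r
  simp only [hl, zero_smul, Finset.sum_const_zero, zero_add, hz] at he
  have hc : a 0 = 0 := by simpa using (congrFun he 0).symm
  apply ha
  ext p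
  rw [a.decomp]
  simp [hlin, hc]

theorem dim_le {v : Fin (n + 1) → Fin d → ℝ} (hv : affineSpan ℝ (v '' Set.univ) = ⊤) : d ≤ n := by
  have hinj : Function.Injective (evalConfig v) := fun f g h =>
    affineMap_ext_of_span hv fun i _ => congrFun h i
  have := LinearMap.finrank_le_finrank_of_injective hinj
  simpa [AffineMap.finrank_eq] using this

theorem span_of_card {v : Fin (n + 1) → Fin d → ℝ} (hgen : InGeneralPosition v)
    {s : Finset (Fin (n + 1))} (hs : d + 1 ≤ s.card) : affineSpan ℝ (v '' (s : Set _)) = ⊤ := by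
  obtain ⟨t, hts, ht⟩ := Finset.exists_subset_card_eq hs
  refine span_mono (G := (t : Set _)) ?_ (Finset.coe_subset.2 hts)
  have := (hgen t ht).affineSpan_eq_top_iff_card_eq_finrank_add_one.2 (by simp [ht])
  rw [← this]
  congr 1
  ext p
  simp

theorem card_le_of_span {v : Fin (n + 1) → Fin d → ℝ} {s : Finset (Fin (n + 1))}
    (hs : affineSpan ℝ (v '' (s : Set _)) = ⊤) : d + 1 ≤ s.card := by
  let R : ((Fin d → ℝ) →ᵃ[ℝ] ℝ) →ₗ[ℝ] (s → ℝ) :=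
    (LinearMap.funLeft ℝ ℝ ((↑) : s → Fin (n + 1))) ∘ₗ evalConfig v
  have hinj : Function.Injective R := fun f g h =>
    affineMap_ext_of_span hs fun i hi => congrFun h ⟨i, hi⟩
  have := LinearMap.finrank_le_finrank_of_injective hinj
  simpa [AffineMap.finrank_eq] using this

/-- After enlarging `s` to `d + 1` labels, restriction is an injective map between spaces of
dimension `d + 1`, hence surjective. -/
theorem exists_interpolation {v : Fin (n + 1) → Fin d → ℝ} (hgen : InGeneralPosition v)
    (hd : d ≤ n) {s : Finset (Fin (n + 1))} (hs : s.card ≤ d + 1) (y : Fin (n + 1) → ℝ) :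
    ∃ f : (Fin d → ℝ) →ᵃ[ℝ] ℝ, ∀ i ∈ s, f (v i) = y i := by
  obtain ⟨t, hst, ht⟩ := Finset.exists_superset_card_eq hs (by simpa using hd)
  let R : ((Fin d → ℝ) →ᵃ[ℝ] ℝ) →ₗ[ℝ] (t → ℝ) :=
    (LinearMap.funLeft ℝ ℝ ((↑) : t → Fin (n + 1))) ∘ₗ evalConfig v
  have hinj : Function.Injective R := fun f g h =>
    affineMap_ext_of_span (span_of_card hgen ht.ge) fun i hi => congrFun h ⟨i, hi⟩
  have hsurj : Function.Surjective R :=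
    (LinearMap.injective_iff_surjective_of_finrank_eq_finrank
      (by simp [AffineMap.finrank_eq, ht])).1 hinj
  obtain ⟨f, hf⟩ := hsurj fun i => y i
  exact ⟨f, fun i hi => congrFun hf ⟨i, hst hi⟩⟩

/-! ### Slack functionals, supporting hyperplanes and refinement -/

/-- The affine functional interpolating the heights over a spanning set of labels, as a linear
function of all the heights. -/
noncomputable def extend (v : Fin (n + 1) → Fin d → ℝ) (G : Set (Fin (n + 1))) :
    (Fin (n + 1) → ℝ) →ₗ[ℝ] ((Fin d → ℝ) →ᵃ[ℝ] ℝ) :=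
  (LinearMap.funLeft ℝ ℝ ((↑) : G → Fin (n + 1)) ∘ₗ evalConfig v).leftInverse ∘ₗ
    LinearMap.funLeft ℝ ℝ ((↑) : G → Fin (n + 1))

theorem extend_eq {v : Fin (n + 1) → Fin d → ℝ} {G : Set (Fin (n + 1))}
    (hG : affineSpan ℝ (v '' G) = ⊤) {y : Fin (n + 1) → ℝ} {f : (Fin d → ℝ) →ᵃ[ℝ] ℝ}
    (h : ∀ i ∈ G, y i = f (v i)) : extend v G y = f := by
  have hinj : LinearMap.ker (LinearMap.funLeft ℝ ℝ ((↑) : G → Fin (n + 1)) ∘ₗ evalConfig v) = ⊥ :=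
    LinearMap.ker_eq_bot.2 fun f g h =>
      affineMap_ext_of_span hG fun i hi => congrFun h ⟨i, hi⟩
  have : LinearMap.funLeft ℝ ℝ ((↑) : G → Fin (n + 1)) y =
      (LinearMap.funLeft ℝ ℝ ((↑) : G → Fin (n + 1)) ∘ₗ evalConfig v) f := by
    ext i
    exact h i i.2
  rw [extend, LinearMap.comp_apply, this, LinearMap.leftInverse_apply_of_inj hinj]

/-- The amount by which the hyperplane through the lifted points with label in `G` passes above
the lifted point with label `i`. -/
noncomputable def slack (v : Fin (n + 1) → Fin d → ℝ) (G : Set (Fin (n + 1))) (i : Fin (n + 1)) :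
    Module.Dual ℝ (Fin (n + 1) → ℝ) :=
  LinearMap.proj i ∘ₗ evalConfig v ∘ₗ extend v G - LinearMap.proj i

theorem slack_apply (v : Fin (n + 1) → Fin d → ℝ) (G : Set (Fin (n + 1))) (i : Fin (n + 1))
    (y : Fin (n + 1) → ℝ) : slack v G i y = extend v G y (v i) - y i := rfl

theorem slack_evalConfig {v : Fin (n + 1) → Fin d → ℝ} {G : Set (Fin (n + 1))}
    (hG : affineSpan ℝ (v '' G) = ⊤) (i : Fin (n + 1)) (f : (Fin d → ℝ) →ᵃ[ℝ] ℝ) :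
    slack v G i (evalConfig v f) = 0 := by
  rw [slack_apply, extend_eq (y := evalConfig v f) hG (f := f) fun _ _ => rfl, evalConfig_apply, sub_self]

theorem one_eq_evalConfig (v : Fin (n + 1) → Fin d → ℝ) :
    (1 : Fin (n + 1) → ℝ) = evalConfig v (AffineMap.const ℝ _ 1) := rfl

/-- Some hyperplane weakly above all the lifted points contains those with label in `G`. -/
def Supports (v : Fin (n + 1) → Fin d → ℝ) (y : Fin (n + 1) → ℝ) (G : Set (Fin (n + 1))) : Prop :=
  ∃ f : (Fin d → ℝ) →ᵃ[ℝ] ℝ, (∀ i, y i ≤ f (v i)) ∧ ∀ i ∈ G, y i = f (v i)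

/-- Since `G` spans, the only candidate for the supporting functional is `extend v G y`; an
existence statement thus becomes a system of linear conditions on `y`. -/
theorem supports_iff_slack {v : Fin (n + 1) → Fin d → ℝ} {G : Set (Fin (n + 1))}
    (hG : affineSpan ℝ (v '' G) = ⊤) {y : Fin (n + 1) → ℝ} :
    Supports v y G ↔ (∀ i, 0 ≤ slack v G i y) ∧ ∀ i ∈ G, slack v G i y = 0 := by
  simp only [slack_apply, sub_nonneg, sub_eq_zero]
  constructor
  · rintro ⟨f, hf, hfG⟩
    rw [extend_eq hG hfG]
    exact ⟨hf, fun i hi => (hfG i hi).symm⟩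
  · rintro ⟨h1, h2⟩
    exact ⟨_, h1, fun i hi => (h2 i hi).symm⟩

theorem supports_iff_facet {v : Fin (n + 1) → Fin d → ℝ} {G : Set (Fin (n + 1))}
    (hG : affineSpan ℝ (v '' G) = ⊤) {y : Fin (n + 1) → ℝ} :
    Supports v y G ↔ ∃ F ∈ regularSubdivision v y, G ⊆ F := by
  constructor
  · rintro ⟨f, hf, hfG⟩
    exact ⟨{i | y i = f (v i)}, ⟨span_mono hG hfG, f, hf, rfl⟩, hfG⟩
  · rintro ⟨F, ⟨-, f, hf, rfl⟩, hGF⟩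
    exact ⟨f, hf, fun i hi => hGF hi⟩

theorem refines_iff_supports {v : Fin (n + 1) → Fin d → ℝ} {x y : Fin (n + 1) → ℝ} :
    Refines (regularSubdivision v x) (regularSubdivision v y) ↔
      ∀ F ∈ regularSubdivision v x, Supports v y F :=
  forall₂_congr fun _ hF => (supports_iff_facet hF.1).symm

theorem refines_refl (S : Set (Set (Fin (n + 1)))) : Refines S S :=
  fun F hF => ⟨F, hF, subset_rfl⟩

theorem Refines.trans {S T U : Set (Set (Fin (n + 1)))} (h : Refines S T) (h' : Refines T U) :
    Refines S U := fun F hF =>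
  let ⟨_, hG, hFG⟩ := h F hF
  let ⟨H, hH, hGH⟩ := h' _ hG
  ⟨H, hH, hFG.trans hGH⟩

theorem CoveredByFacets.of_refines {k : ℕ} {S T : Set (Set (Fin (n + 1)))}
    (hS : CoveredByFacets k S) (h : Refines S T) : CoveredByFacets k T := by
  obtain ⟨F, hF, hU⟩ := hS
  choose G hG hFG using fun j => h (F j) (hF j)
  exact ⟨G, hG, Set.univ_subset_iff.1 (hU ▸ Set.iUnion_mono hFG)⟩

/-! ### Facets cover the convex hull -/

theorem eventually_add_mul_pos {b : ℝ} (hb : 0 < b) (c : ℝ) : ∀ᶠ t : ℝ in nhds 0, 0 < b + t * c := by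
  have hc : Continuous fun t : ℝ => b + t * c := by fun_prop
  exact (hc.tendsto 0).eventually (lt_mem_nhds (by simpa using hb))

theorem affineMap_nonneg_of_mem_convexHull {s : Set (Fin d → ℝ)} {a : (Fin d → ℝ) →ᵃ[ℝ] ℝ}
    (h : ∀ q ∈ s, 0 ≤ a q) {p : Fin d → ℝ} (hp : p ∈ convexHull ℝ s) : 0 ≤ a p :=
  convexHull_min (s := s) (t := a ⁻¹' Set.Ici 0) h ((convex_Ici 0).affine_preimage a) hp

/-- Pushing an affine functional towards the lifted points in a direction vanishing on its tight
labels makes a further label tight. -/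
theorem exists_tight_of_neg {v : Fin (n + 1) → Fin d → ℝ} {x : Fin (n + 1) → ℝ}
    {f a : (Fin d → ℝ) →ᵃ[ℝ] ℝ} (hf : ∀ i, x i ≤ f (v i)) (ha : ∀ i, x i = f (v i) → a (v i) = 0)
    (hneg : ∃ i, a (v i) < 0) :
    ∃ t : ℝ, 0 ≤ t ∧ (∀ i, x i ≤ (f + t • a) (v i)) ∧
      {i | x i = f (v i)} ⊂ {i | x i = (f + t • a) (v i)} := by
  classical
  let N : Finset (Fin (n + 1)) := Finset.univ.filter fun i => a (v i) < 0
  have hN : N.Nonempty := let ⟨i, hi⟩ := hneg; ⟨i, by simpa [N] using hi⟩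
  -- Ratio test: `j` is the first label reached when moving along `a`.
  obtain ⟨j, hj, hmin⟩ := N.exists_min_image (fun i => (f (v i) - x i) / (-a (v i))) hN
  have hja : a (v j) < 0 := by simpa [N] using hj
  set t : ℝ := (f (v j) - x j) / (-a (v j)) with ht
  have ht0 : 0 ≤ t := div_nonneg (sub_nonneg.2 (hf j)) (by linarith)
  have hval : ∀ i, (f + t • a) (v i) = f (v i) + t * a (v i) := fun i => rfl
  refine ⟨t, ht0, fun i => ?_, (Set.ssubset_iff_of_subset fun i hi => ?_).2 ⟨j, ?_, fun h => ?_⟩⟩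
  · rw [hval]
    rcases lt_or_ge (a (v i)) 0 with hi | hi
    · have := hmin i (by simpa [N] using hi)
      rw [le_div_iff₀ (by linarith)] at this
      linarith
    · nlinarith [hf i]
  · rw [Set.mem_ofPred_eq, hval, ha i hi, mul_zero, add_zero]
    exact hi
  · rw [Set.mem_ofPred_eq, hval, ht]
    have := hja.ne
    field_simp
    ring
  · exact hja.ne (ha j h)

/-- While the tight labels do not span, some nonzero affine functional vanishes on them, and moving
along it makes a new label tight. Its sign can be chosen so that the value at `p` does not increase.
Induction is on the growing tight set. -/
theorem exists_facet_of_le {v : Fin (n + 1) → Fin d → ℝ}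
    (hv : affineSpan ℝ (v '' Set.univ) = ⊤) {x : Fin (n + 1) → ℝ} {p : Fin d → ℝ}
    (hp : p ∈ convexHull ℝ (Set.range v)) :
    ∀ f : (Fin d → ℝ) →ᵃ[ℝ] ℝ, (∀ i, x i ≤ f (v i)) →
      ∃ g : (Fin d → ℝ) →ᵃ[ℝ] ℝ, (∀ i, x i ≤ g (v i)) ∧
        affineSpan ℝ (v '' {i | x i = g (v i)}) = ⊤ ∧
        {i | x i = f (v i)} ⊆ {i | x i = g (v i)} ∧ g p ≤ f p := by
  suffices H : ∀ T : Set (Fin (n + 1)), ∀ f : (Fin d → ℝ) →ᵃ[ℝ] ℝ, (∀ i, x i ≤ f (v i)) →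
      {i | x i = f (v i)} = T → ∃ g : (Fin d → ℝ) →ᵃ[ℝ] ℝ, (∀ i, x i ≤ g (v i)) ∧
        affineSpan ℝ (v '' {i | x i = g (v i)}) = ⊤ ∧
        {i | x i = f (v i)} ⊆ {i | x i = g (v i)} ∧ g p ≤ f p from fun f hf => H _ f hf rfl
  intro T
  induction T using WellFoundedGT.induction with
  | ind T ih =>
  intro f hf hT
  by_cases hs : affineSpan ℝ (v '' {i | x i = f (v i)}) = ⊤
  · exact ⟨f, hf, hs, subset_rfl, le_rfl⟩
  obtain ⟨a, ha, h0⟩ : ∃ a : (Fin d → ℝ) →ᵃ[ℝ] ℝ, (∃ i, a (v i) < 0) ∧ a p ≤ 0 ∧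
      ∀ i, x i = f (v i) → a (v i) = 0 := by
    obtain ⟨a, ha, h0⟩ := exists_affineMap_ne_zero_of_affineSpan_ne_top hs
    have h0' : ∀ i, x i = f (v i) → a (v i) = 0 := fun i hi => h0 _ ⟨i, hi, rfl⟩
    wlog hap : a p ≤ 0 generalizing a
    · refine this (-a) (neg_ne_zero.2 ha) (fun q hq => ?_) (fun i hi => ?_) ?_
      · simp [h0 q hq]
      · simp [h0' i hi]
      · simp only [AffineMap.coe_neg, Pi.neg_apply]
        linarith
    by_cases hneg : ∃ i, a (v i) < 0
    · exact ⟨a, hneg, hap, h0'⟩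
    · push Not at hneg
      -- Here `a` is nonnegative on the hull and so vanishes at `p`: reversing its sign costs
      -- nothing there, and gives a negative value at some label.
      have hap' : 0 ≤ a p :=
        affineMap_nonneg_of_mem_convexHull (by rintro _ ⟨i, rfl⟩; exact hneg i) hp
      obtain ⟨j, hj⟩ : ∃ j, a (v j) ≠ 0 := by
        by_contra! h
        exact ha (affineMap_ext_of_span hv fun i _ => by simp [h i])
      refine ⟨-a, ⟨j, ?_⟩, ?_, fun i hi => ?_⟩
      · simpa using lt_of_le_of_ne (hneg j) hj.symm
      · simpa using hap'
      · simp [h0' i hi]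
  obtain ⟨t, ht, hft, hss⟩ := exists_tight_of_neg hf h0.2 ha
  obtain ⟨g, hg, hgs, hsub, hle⟩ := ih _ (hT ▸ hss) (f + t • a) hft rfl
  refine ⟨g, hg, hgs, hss.subset.trans hsub, hle.trans ?_⟩
  have : (f + t • a) p = f p + t * a p := rfl
  nlinarith [h0.1]

theorem exists_affineMap_ge (v : Fin (n + 1) → Fin d → ℝ) (x : Fin (n + 1) → ℝ) :
    ∃ f : (Fin d → ℝ) →ᵃ[ℝ] ℝ, ∀ i, x i ≤ f (v i) :=
  ⟨AffineMap.const ℝ _ (Finset.univ.sup' Finset.univ_nonempty x), fun i =>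
    Finset.le_sup' x (Finset.mem_univ i)⟩

theorem exists_facet_of_supports {v : Fin (n + 1) → Fin d → ℝ}
    (hv : affineSpan ℝ (v '' Set.univ) = ⊤) {x : Fin (n + 1) → ℝ} {G : Set (Fin (n + 1))}
    (h : Supports v x G) : ∃ F ∈ regularSubdivision v x, G ⊆ F := by
  obtain ⟨f, hf, hfG⟩ := h
  obtain ⟨g, hg, hs, hsub, -⟩ := exists_facet_of_le hv (x := x) (p := v 0)
    (subset_convexHull ℝ _ ⟨0, rfl⟩) f hf
  exact ⟨_, ⟨hs, g, hg, rfl⟩, fun i hi => hsub (hfG i hi)⟩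

/-- The facets of a regular subdivision cover the convex hull of the configuration. -/
theorem exists_facet_mem_convexHull {v : Fin (n + 1) → Fin d → ℝ}
    (hv : affineSpan ℝ (v '' Set.univ) = ⊤) (x : Fin (n + 1) → ℝ) {p : Fin d → ℝ}
    (hp : p ∈ convexHull ℝ (Set.range v)) :
    ∃ F ∈ regularSubdivision v x, p ∈ convexHull ℝ (v '' F) := by
  obtain ⟨f₀, hf₀⟩ := exists_affineMap_ge v x
  obtain ⟨g₀, hg₀, hs₀, -⟩ := exists_facet_of_le hv hp f₀ hf₀
  -- The facet sought is one whose hyperplane is lowest over `p`. If `p` were outside its hull,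
  -- tilting by a functional positive on `F` and negative at `p` would yield a lower one.
  obtain ⟨F, hF, hmin⟩ := Set.exists_min_image (regularSubdivision v x)
    (fun F => extend v F x p) (Set.toFinite _) ⟨_, hs₀, g₀, hg₀, rfl⟩
  refine ⟨F, hF, ?_⟩
  obtain ⟨hFs, f, hf, hFf⟩ := hF
  have hext : extend v F x = f := extend_eq hFs fun i hi => by rw [hFf] at hi; exact hi
  rw [hext] at hmin
  by_contra hpF
  obtain ⟨l, u, hlp, hl⟩ := geometric_hahn_banach_point_closed (convex_convexHull ℝ _)
    ((Set.toFinite (v '' F)).isClosed_convexHull ℝ) hpF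
  let a : (Fin d → ℝ) →ᵃ[ℝ] ℝ := (l : (Fin d → ℝ) →ₗ[ℝ] ℝ).toAffineMap - AffineMap.const ℝ _ u
  have hap : a p < 0 := by simpa [a] using hlp
  have haF : ∀ i ∈ F, 0 < a (v i) := fun i hi => by
    simpa [a] using hl _ (subset_convexHull ℝ _ ⟨i, hi, rfl⟩)
  have hev : ∀ᶠ t : ℝ in nhdsWithin 0 (Set.Ioi 0), ∀ i, x i ≤ f (v i) + t * a (v i) := by
    rw [Filter.eventually_all]
    intro i
    by_cases hi : i ∈ F
    · filter_upwards [self_mem_nhdsWithin] with t ht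
      have ht : 0 < t := ht
      linarith [mul_pos ht (haF i hi), hf i]
    · have hlt : 0 < f (v i) - x i :=
        sub_pos.2 (lt_of_le_of_ne (hf i) fun h => hi (by rw [hFf]; exact h))
      filter_upwards [nhdsWithin_le_nhds (eventually_add_mul_pos hlt (a (v i)))] with t ht
      linarith
  obtain ⟨t, ht, ht0⟩ := (hev.and self_mem_nhdsWithin).exists
  have ht0 : 0 < t := ht0
  obtain ⟨g, hg, hgs, -, hgp⟩ := exists_facet_of_le hv hp (f + t • a) ht
  have h1 := hmin _ ⟨hgs, g, hg, rfl⟩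
  rw [extend_eq hgs (f := g) fun i hi => hi] at h1
  have h2 : (f + t • a) p = f p + t * a p := rfl
  nlinarith

/-- If a regular subdivision refines another one, then every facet of the coarser one contains a
facet of the finer one. -/
theorem exists_facet_subset {v : Fin (n + 1) → Fin d → ℝ}
    (hv : affineSpan ℝ (v '' Set.univ) = ⊤) {x y : Fin (n + 1) → ℝ}
    (h : Refines (regularSubdivision v x) (regularSubdivision v y))
    {G : Set (Fin (n + 1))} (hG : G ∈ regularSubdivision v y) :
    ∃ F ∈ regularSubdivision v x, F ⊆ G ∧ extend v F y = extend v G y := by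
  classical
  obtain ⟨hGs, g, hg, hGg⟩ := hG
  have hGg' : ∀ i ∈ G, y i = g (v i) := fun i hi => by rw [hGg] at hi; exact hi
  have hne : G.toFinset.Nonempty := by simpa using span_nonempty hGs
  have hcard : (0 : ℝ) < G.toFinset.card := by exact_mod_cast hne.card_pos
  -- The barycentre of `G` gives every label positive weight. With `F` a facet of the finer
  -- subdivision over `p`, `g ≥ f` on `F` gives `g p ≥ f p`, while `f ≥ g` on `G`; averaging forces
  -- equality on all of `G`.
  set p : Fin d → ℝ := G.toFinset.centerMass (fun _ => (1 : ℝ)) v with hp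
  have hpG : p ∈ convexHull ℝ (v '' G) :=
    Finset.centerMass_mem_convexHull _ (by simp) (by rw [Finset.sum_const, nsmul_one]; exact hcard)
      fun i hi => ⟨i, Set.mem_toFinset.1 hi, rfl⟩
  have hmap : ∀ a : (Fin d → ℝ) →ᵃ[ℝ] ℝ,
      a p * G.toFinset.card = ∑ i ∈ G.toFinset, a (v i) := by
    intro a
    have h1 : ∀ q, a q = a.linear q + a 0 := fun q => by
      conv_lhs => rw [a.decomp]
      simp
    rw [h1 p, hp, Finset.centerMass]
    simp only [h1 (v _), Finset.sum_add_distrib, Finset.sum_const, nsmul_eq_mul, mul_one, one_smul,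
      map_smul, map_sum, smul_eq_mul]
    field_simp
  obtain ⟨F, hF, hpF⟩ := exists_facet_mem_convexHull hv x
    (convexHull_mono (Set.image_subset_range _ _) hpG)
  obtain ⟨f, hf, hfF⟩ := refines_iff_supports.1 h F hF
  have hle : 0 ≤ (g - f) p := by
    refine affineMap_nonneg_of_mem_convexHull (s := v '' F) ?_ hpF
    rintro _ ⟨i, hi, rfl⟩
    have := hg i
    have := hfF i hi
    simp only [AffineMap.coe_sub, Pi.sub_apply]
    linarith
  have hnn : ∀ i ∈ G.toFinset, 0 ≤ (f - g) (v i) := by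
    intro i hi
    have := hGg' i (by simpa using hi)
    have := hf i
    simp only [AffineMap.coe_sub, Pi.sub_apply]
    linarith
  have hsum : ∑ i ∈ G.toFinset, (f - g) (v i) = 0 := by
    refine le_antisymm ?_ (Finset.sum_nonneg hnn)
    rw [← hmap]
    have : (f - g) p = -((g - f) p) := by simp
    nlinarith
  have hfg : f = g := affineMap_ext_of_span hGs fun i hi => by
    have := (Finset.sum_eq_zero_iff_of_nonneg hnn).1 hsum i (by simpa using hi)
    simpa [sub_eq_zero] using this
  subst hfg
  refine ⟨F, hF, fun i hi => by rw [hGg]; exact hfF i hi, ?_⟩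
  rw [extend_eq hF.1 hfF, extend_eq hGs hGg']

/-- Inside a closed cell, the closed cell of the subdivision induced by `y` is cut out by the
constraints which are tight at `y`. -/
theorem refines_iff_tight {v : Fin (n + 1) → Fin d → ℝ}
    (hv : affineSpan ℝ (v '' Set.univ) = ⊤) {x y z : Fin (n + 1) → ℝ}
    (h : Refines (regularSubdivision v x) (regularSubdivision v y)) :
    Refines (regularSubdivision v y) (regularSubdivision v z) ↔
      Refines (regularSubdivision v x) (regularSubdivision v z) ∧
        ∀ F ∈ regularSubdivision v x, ∀ i, slack v F i y = 0 → slack v F i z = 0 := by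
  constructor
  · refine fun h' => ⟨h.trans h', fun F hF i hi => ?_⟩
    obtain ⟨f, hf, hfF⟩ := refines_iff_supports.1 h F hF
    rw [slack_apply, extend_eq hF.1 hfF, sub_eq_zero] at hi
    -- Zero slack at `i` means that the hyperplane of `F` also contains the lifted point `i`, so one
    -- facet at `y` contains both `F` and `i`.
    have hs : Supports v y (insert i F) := ⟨f, hf, by
      rintro j (rfl | hj)
      exacts [hi.symm, hfF j hj]⟩
    obtain ⟨G, hG, hsub⟩ := exists_facet_of_supports hv hs
    obtain ⟨g, hg, hgG⟩ := refines_iff_supports.1 h' G hG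
    rw [slack_apply, extend_eq hF.1 (fun j hj => hgG j (hsub (Or.inr hj))), sub_eq_zero]
    exact (hgG i (hsub (Or.inl rfl))).symm
  · rintro ⟨hz, ht⟩
    refine refines_iff_supports.2 fun G hG => ?_
    obtain ⟨F, hF, hFG, hext⟩ := exists_facet_subset hv h hG
    obtain ⟨f, hf, hfF⟩ := refines_iff_supports.1 hz F hF
    refine ⟨f, hf, fun i hi => ?_⟩
    have h0 := ht F hF i (by
      rw [slack_apply, hext, ← slack_apply]
      exact ((supports_iff_slack hG.1).1 (refines_iff_supports.1 (refines_refl _) G hG)).2 i hi)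
    rw [slack_apply, extend_eq hF.1 hfF, sub_eq_zero] at h0
    exact h0.symm

/-! ### Cells as polyhedra and their faces -/

/-- The slack functional on tropical projective space. -/
noncomputable def projSlack (v : Fin (n + 1) → Fin d → ℝ) (G : Set (Fin (n + 1)))
    (i : Fin (n + 1)) : Module.Dual ℝ (TP n) :=
  open Classical in
  if h : Submodule.span ℝ {(1 : Fin (n + 1) → ℝ)} ≤ LinearMap.ker (slack v G i) then
    Submodule.liftQ _ (slack v G i) h
  -- The default never occurs for spanning `G`: slack then vanishes on constant heights.
  else 0

theorem projSlack_proj {v : Fin (n + 1) → Fin d → ℝ} {G : Set (Fin (n + 1))}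
    (hG : affineSpan ℝ (v '' G) = ⊤) (i : Fin (n + 1)) (y : Fin (n + 1) → ℝ) :
    projSlack v G i (proj n y) = slack v G i y := by
  have h : Submodule.span ℝ {(1 : Fin (n + 1) → ℝ)} ≤ LinearMap.ker (slack v G i) := by
    rw [Submodule.span_singleton_le_iff_mem, LinearMap.mem_ker, one_eq_evalConfig v,
      slack_evalConfig hG]
  rw [projSlack, dif_pos h, Submodule.mkQ_apply, Submodule.liftQ_apply]

theorem proj_surjective (p : TP n) : ∃ y, proj n y = p :=
  Submodule.mkQ_surjective _ p

theorem refines_iff_projSlack {v : Fin (n + 1) → Fin d → ℝ} {x y : Fin (n + 1) → ℝ} :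
    Refines (regularSubdivision v x) (regularSubdivision v y) ↔
      ∀ F ∈ regularSubdivision v x, (∀ i, 0 ≤ projSlack v F i (proj n y)) ∧
        ∀ i ∈ F, projSlack v F i (proj n y) = 0 := by
  rw [refines_iff_supports]
  refine forall₂_congr fun F hF => ?_
  simp only [projSlack_proj hF.1, supports_iff_slack hF.1]

theorem mem_cell_iff {v : Fin (n + 1) → Fin d → ℝ} {x : Fin (n + 1) → ℝ} {p : TP n} :
    p ∈ cell v (regularSubdivision v x) ↔
      ∀ F ∈ regularSubdivision v x, (∀ i, 0 ≤ projSlack v F i p) ∧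
        ∀ i ∈ F, projSlack v F i p = 0 := by
  constructor
  · rintro ⟨y, hy, rfl⟩
    exact refines_iff_projSlack.1 hy
  · obtain ⟨y, rfl⟩ := proj_surjective p
    exact fun h => ⟨y, refines_iff_projSlack.2 h, rfl⟩

theorem proj_mem_cell_iff {v : Fin (n + 1) → Fin d → ℝ} {x y : Fin (n + 1) → ℝ} :
    proj n y ∈ cell v (regularSubdivision v x) ↔
      Refines (regularSubdivision v x) (regularSubdivision v y) :=
  mem_cell_iff.trans refines_iff_projSlack.symm

theorem proj_mem_cell_self (v : Fin (n + 1) → Fin d → ℝ) (x : Fin (n + 1) → ℝ) :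
    proj n x ∈ cell v (regularSubdivision v x) :=
  proj_mem_cell_iff.2 (refines_refl _)

theorem cell_subset_cell {v : Fin (n + 1) → Fin d → ℝ} {x y : Fin (n + 1) → ℝ}
    (h : Refines (regularSubdivision v x) (regularSubdivision v y)) :
    cell v (regularSubdivision v y) ⊆ cell v (regularSubdivision v x) := by
  rintro _ ⟨z, hz, rfl⟩
  exact ⟨z, h.trans hz, rfl⟩

theorem mem_cell_iff_tight {v : Fin (n + 1) → Fin d → ℝ}
    (hv : affineSpan ℝ (v '' Set.univ) = ⊤) {x y : Fin (n + 1) → ℝ}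
    (h : Refines (regularSubdivision v x) (regularSubdivision v y)) {p : TP n} :
    p ∈ cell v (regularSubdivision v y) ↔ p ∈ cell v (regularSubdivision v x) ∧
      ∀ c : regularSubdivision v x × Fin (n + 1),
        projSlack v c.1 c.2 (proj n y) = 0 → projSlack v c.1 c.2 p = 0 := by
  obtain ⟨z, rfl⟩ := proj_surjective p
  rw [proj_mem_cell_iff, proj_mem_cell_iff, refines_iff_tight hv h]
  refine and_congr_right fun _ => ⟨fun H c => ?_, fun H F hF i => ?_⟩
  · rw [projSlack_proj c.1.2.1, projSlack_proj c.1.2.1]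
    exact H _ c.1.2 _
  · rw [← projSlack_proj hF.1, ← projSlack_proj hF.1]
    exact H (⟨F, hF⟩, i)

theorem convex_cell (v : Fin (n + 1) → Fin d → ℝ) (x : Fin (n + 1) → ℝ) :
    Convex ℝ (cell v (regularSubdivision v x)) := by
  intro p hp q hq a b ha hb _
  rw [mem_cell_iff] at *
  refine fun F hF => ⟨fun i => ?_, fun i hi => ?_⟩
  · have := (hp F hF).1 i
    have := (hq F hF).1 i
    simp only [map_add, map_smul, smul_eq_mul]
    positivity
  · simp [(hp F hF).2 i hi, (hq F hF).2 i hi]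

theorem isPolyhedron_cell (v : Fin (n + 1) → Fin d → ℝ) (x : Fin (n + 1) → ℝ) :
    IsPolyhedron (cell v (regularSubdivision v x)) := by
  classical
  let U : Set (Module.Dual ℝ (TP n) × ℝ) :=
    Set.range (fun c : regularSubdivision v x × Fin (n + 1) => (-projSlack v c.1 c.2, 0)) ∪
      Set.range (fun c : Σ F : regularSubdivision v x, F.1 => (projSlack v c.1 c.2, 0))
  have hU : U.Finite := (Set.finite_range _).union (Set.finite_range _)
  refine ⟨hU.toFinset, ?_⟩
  ext p
  simp only [mem_cell_iff, Set.Finite.mem_toFinset, Set.mem_ofPred_eq]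
  constructor
  · rintro h c (⟨⟨F, i⟩, rfl⟩ | ⟨⟨F, i⟩, rfl⟩)
    · simpa using (h F F.2).1 i
    · exact ((h F F.2).2 i i.2).le
  · intro h F hF
    have h1 : ∀ i, 0 ≤ projSlack v F i p := fun i => by
      simpa using h _ (Or.inl ⟨(⟨F, hF⟩, i), rfl⟩)
    exact ⟨h1, fun i hi => le_antisymm (h _ (Or.inr ⟨⟨⟨F, hF⟩, ⟨i, hi⟩⟩, rfl⟩)) (h1 i)⟩

/-- A nonempty convex set on which finitely many functionals are nonnegative contains a point at
which as few of them vanish as possible. -/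
theorem exists_minimal_tight {E ι : Type*} [AddCommGroup E] [Module ℝ E] [Finite ι]
    {A : Set E} (hA : Convex ℝ A) (hne : A.Nonempty) (σ : ι → Module.Dual ℝ E)
    (hσ : ∀ c, ∀ p ∈ A, 0 ≤ σ c p) : ∃ p ∈ A, ∀ q ∈ A, ∀ c, σ c p = 0 → σ c q = 0 := by
  obtain ⟨p, hp, hmin⟩ : ∃ p ∈ A, ∀ q ∈ A,
      {c | σ c p = 0}.ncard ≤ {c | σ c q = 0}.ncard := by
    obtain ⟨p, hp, hmin⟩ := (measure fun p => {c | σ c p = 0}.ncard).wf.has_min A hne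
    exact ⟨p, hp, fun q hq => not_lt.1 (hmin q hq)⟩
  refine ⟨p, hp, fun q hq c hc => ?_⟩
  -- A nonnegative functional vanishes at the midpoint only if it vanishes at both ends, so
  -- minimality at `p` makes the two zero sets equal.
  have hm := hA hp hq (by norm_num : (0 : ℝ) ≤ 1 / 2) (by norm_num : (0 : ℝ) ≤ 1 / 2) (by norm_num)
  have hval : ∀ c, σ c ((1 / 2 : ℝ) • p + (1 / 2 : ℝ) • q) = 1 / 2 * σ c p + 1 / 2 * σ c q := by
    simp
  have hsub : {c | σ c ((1 / 2 : ℝ) • p + (1 / 2 : ℝ) • q) = 0} ⊆ {c | σ c p = 0} := by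
    intro c hc
    rw [Set.mem_ofPred_eq, hval] at hc
    have := hσ c p hp
    have := hσ c q hq
    rw [Set.mem_ofPred_eq]
    linarith
  have heq := Set.eq_of_subset_of_ncard_le hsub (hmin _ hm)
  have hc' : c ∈ {c | σ c p = 0} := hc
  rw [← heq, Set.mem_ofPred_eq, hval, hc] at hc'
  linarith

/-- The exposing functional is minus the sum of the slacks tight at `y`: it is nonpositive on the
large cell, and zero exactly where all of these slacks vanish. -/
theorem isFace_cell {v : Fin (n + 1) → Fin d → ℝ}
    (hv : affineSpan ℝ (v '' Set.univ) = ⊤) {x y : Fin (n + 1) → ℝ}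
    (h : Refines (regularSubdivision v x) (regularSubdivision v y)) :
    IsFace (cell v (regularSubdivision v x)) (cell v (regularSubdivision v y)) := by
  classical
  let T : Finset (regularSubdivision v x × Fin (n + 1)) :=
    Finset.univ.filter fun c => projSlack v c.1 c.2 (proj n y) = 0
  have hT : ∀ c, c ∈ T ↔ projSlack v c.1 c.2 (proj n y) = 0 := fun c => by
    rw [Finset.mem_filter_univ]
  let l : Module.Dual ℝ (TP n) := -∑ c ∈ T, projSlack v c.1 c.2
  have hl : ∀ p, l p = -∑ c ∈ T, projSlack v c.1 c.2 p := by simp [l]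
  have hnn : ∀ p ∈ cell v (regularSubdivision v x), ∀ c ∈ T, 0 ≤ projSlack v c.1 c.2 p :=
    fun p hp c _ => (mem_cell_iff.1 hp _ c.1.2).1 c.2
  refine ⟨l, ?_⟩
  ext p
  rw [mem_cell_iff_tight hv h, Set.mem_ofPred_eq]
  refine and_congr_right fun hp => ⟨fun ht q hq => ?_, fun ht c hc => ?_⟩
  · rw [hl, hl, Finset.sum_eq_zero fun c hc => ht c ((hT c).1 hc), neg_zero, neg_nonpos]
    exact Finset.sum_nonneg (hnn q hq)
  · have := ht _ (proj_mem_cell_iff.2 h)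
    rw [hl, hl, Finset.sum_eq_zero fun c hc => (hT c).1 hc, neg_zero, neg_nonneg] at this
    exact (Finset.sum_eq_zero_iff_of_nonneg (hnn p hp)).1
      (le_antisymm this (Finset.sum_nonneg (hnn p hp))) c ((hT c).2 hc)

/-- Every nonempty convex subset of a cell has a point whose own cell contains the subset. -/
theorem exists_subset_cell {v : Fin (n + 1) → Fin d → ℝ}
    (hv : affineSpan ℝ (v '' Set.univ) = ⊤) {x : Fin (n + 1) → ℝ} {A : Set (TP n)}
    (hA : Convex ℝ A) (hne : A.Nonempty) (hsub : A ⊆ cell v (regularSubdivision v x)) :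
    ∃ y, proj n y ∈ A ∧ A ⊆ cell v (regularSubdivision v y) := by
  obtain ⟨p, hp, ht⟩ := exists_minimal_tight hA hne
    (fun c : regularSubdivision v x × Fin (n + 1) => projSlack v c.1 c.2)
    fun c p hp => (mem_cell_iff.1 (hsub hp) _ c.1.2).1 c.2
  obtain ⟨y, rfl⟩ := proj_surjective p
  exact ⟨y, hp, fun q hq =>
    (mem_cell_iff_tight hv (proj_mem_cell_iff.1 (hsub hp))).2 ⟨hsub hq, ht q hq⟩⟩

/-- A point `y` of the face with fewest tight slacks plays the role of a relative interior point.
For `p` in its cell, the segment from `p` to `y` extends slightly beyond `y` inside the large cell,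
so maximality of `l` at `y` forces it at `p`. -/
theorem eq_cell_of_isFace {v : Fin (n + 1) → Fin d → ℝ}
    (hv : affineSpan ℝ (v '' Set.univ) = ⊤) {x : Fin (n + 1) → ℝ} {A : Set (TP n)}
    (hA : IsFace (cell v (regularSubdivision v x)) A) (hne : A.Nonempty) :
    ∃ y, Refines (regularSubdivision v x) (regularSubdivision v y) ∧
      A = cell v (regularSubdivision v y) := by
  obtain ⟨l, rfl⟩ := hA
  have hconv : Convex ℝ {p ∈ cell v (regularSubdivision v x) |
      ∀ q ∈ cell v (regularSubdivision v x), l q ≤ l p} := by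
    intro p hp q hq a b ha hb hab
    refine ⟨convex_cell v x hp.1 hq.1 ha hb hab, fun r hr => ?_⟩
    have h1 := mul_le_mul_of_nonneg_left (hp.2 r hr) ha
    have h2 := mul_le_mul_of_nonneg_left (hq.2 r hr) hb
    simp only [map_add, map_smul, smul_eq_mul]
    calc l r = a * l r + b * l r := by rw [← add_mul, hab, one_mul]
      _ ≤ _ := add_le_add h1 h2
  obtain ⟨y, ⟨hy, hmax⟩, hsub⟩ := exists_subset_cell hv hconv hne fun p hp => hp.1
  have hxy := proj_mem_cell_iff.1 hy
  refine ⟨y, hxy, hsub.antisymm fun p hp => ?_⟩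
  obtain ⟨hpx, ht⟩ := (mem_cell_iff_tight hv hxy).1 hp
  refine ⟨hpx, fun q hq => (hmax q hq).trans ?_⟩
  -- Slacks tight at `y` also vanish at `p`; the others are positive at `y` and stay so for small
  -- `t`.
  have hev : ∀ᶠ t : ℝ in nhdsWithin 0 (Set.Ioi 0), ∀ c : regularSubdivision v x × Fin (n + 1),
      0 ≤ projSlack v c.1 c.2 (proj n y) +
        t * (projSlack v c.1 c.2 (proj n y) - projSlack v c.1 c.2 p) := by
    rw [Filter.eventually_all]
    intro c
    rcases ((mem_cell_iff.1 hy _ c.1.2).1 c.2).eq_or_lt with h0 | h0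
    · rw [ht c h0.symm, ← h0]
      simp
    · filter_upwards [nhdsWithin_le_nhds (eventually_add_mul_pos h0 _)] with t ht using ht.le
  obtain ⟨t, ht', ht0⟩ := (hev.and self_mem_nhdsWithin).exists
  have ht0 : 0 < t := ht0
  have hmem : proj n y + t • (proj n y - p) ∈ cell v (regularSubdivision v x) := by
    rw [mem_cell_iff]
    refine fun F hF => ⟨fun i => ?_, fun i hi => ?_⟩
    · have := ht' (⟨F, hF⟩, i)
      simpa only [map_add, map_smul, map_sub, smul_eq_mul] using this
    · have h1 := (mem_cell_iff.1 hy F hF).2 i hi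
      have h2 := (mem_cell_iff.1 hpx F hF).2 i hi
      simp only [map_add, map_smul, map_sub, smul_eq_mul, h1, h2]
      ring
  have := hmax _ hmem
  simp only [map_add, map_smul, map_sub, smul_eq_mul] at this
  nlinarith

/-- Validity passes to coarser subdivisions, so faces remain in the collection. An intersection of
two cells is the cell of one of its points with fewest tight slacks. -/
theorem isPolyhedralComplex_secantCells {v : Fin (n + 1) → Fin d → ℝ}
    (hv : affineSpan ℝ (v '' Set.univ) = ⊤) (k : ℕ) :
    IsPolyhedralComplex (secantCells k v) where
  finite := (Set.finite_range (cell v)).subset fun _ ⟨_, _, h⟩ => ⟨_, h.symm⟩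
  isPolyhedron := by
    rintro _ ⟨x, _, rfl⟩
    exact isPolyhedron_cell v x
  nonempty := by
    rintro _ ⟨x, _, rfl⟩
    exact ⟨_, proj_mem_cell_self v x⟩
  face_mem := by
    rintro _ ⟨x, hx, rfl⟩ A hA hne
    obtain ⟨y, hy, rfl⟩ := eq_cell_of_isFace hv hA hne
    exact ⟨y, hx.of_refines hy, rfl⟩
  inter_isFace := by
    rintro _ ⟨x, _, rfl⟩ _ ⟨y, _, rfl⟩ hne
    obtain ⟨z, hz, hsub⟩ := exists_subset_cell hv ((convex_cell v x).inter (convex_cell v y)) hne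
      Set.inter_subset_left
    rw [hsub.antisymm (Set.subset_inter (cell_subset_cell (proj_mem_cell_iff.1 hz.1))
      (cell_subset_cell (proj_mem_cell_iff.1 hz.2)))]
    exact isFace_cell hv (proj_mem_cell_iff.1 hz.1)

/-! ### The secant variety as the union of the valid cells -/

theorem eq_tropSum_of_covered {v : Fin (n + 1) → Fin d → ℝ} {k : ℕ} {x : Fin (n + 1) → ℝ}
    {f : Fin (k + 1) → (Fin d → ℝ) →ᵃ[ℝ] ℝ} (hle : ∀ j i, x i ≤ f j (v i))
    (heq : ∀ i, ∃ j, x i = f j (v i)) : x = tropSum fun j => evalConfig v (f j) := by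
  ext i
  obtain ⟨j, hj⟩ := heq i
  refine le_antisymm (Finset.le_inf' _ _ fun j _ => hle j i) ?_
  rw [hj]
  exact Finset.inf'_le _ (Finset.mem_univ j)

theorem covered_of_supports {v : Fin (n + 1) → Fin d → ℝ}
    (hv : affineSpan ℝ (v '' Set.univ) = ⊤) {k : ℕ} {x : Fin (n + 1) → ℝ}
    {f : Fin (k + 1) → (Fin d → ℝ) →ᵃ[ℝ] ℝ} (hle : ∀ j i, x i ≤ f j (v i))
    (heq : ∀ i, ∃ j, x i = f j (v i)) : CoveredByFacets k (regularSubdivision v x) := by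
  choose F hF hsub using fun j => exists_facet_of_supports hv
    (x := x) (G := {i | x i = f j (v i)}) ⟨f j, hle j, fun i hi => hi⟩
  refine ⟨F, hF, Set.eq_univ_of_forall fun i => ?_⟩
  obtain ⟨j, hj⟩ := heq i
  exact Set.mem_iUnion.2 ⟨j, hsub j hj⟩

theorem exists_affineMap_of_covered {v : Fin (n + 1) → Fin d → ℝ} {k : ℕ} {x : Fin (n + 1) → ℝ}
    (h : CoveredByFacets k (regularSubdivision v x)) :
    ∃ f : Fin (k + 1) → (Fin d → ℝ) →ᵃ[ℝ] ℝ, (∀ j i, x i ≤ f j (v i)) ∧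
      (∀ j, affineSpan ℝ (v '' {i | x i = f j (v i)}) = ⊤) ∧ ∀ i, ∃ j, x i = f j (v i) := by
  obtain ⟨F, hF, hU⟩ := h
  choose hs f hf hFf using hF
  refine ⟨f, hf, fun j => hFf j ▸ hs j, fun i => ?_⟩
  obtain ⟨j, hj⟩ := Set.mem_iUnion.1 (hU ▸ Set.mem_univ i)
  rw [hFf j] at hj
  exact ⟨j, hj⟩

theorem sUnion_secantCells {L : Submodule ℝ (TP n)} {M : Matrix (Fin d) (Fin (n + 1)) ℝ}
    (hM : IsAssociatedMatrix M L) (k : ℕ) :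
    ⋃₀ secantCells k (pointConfig M) = secantVariety k L := by
  have hv := affineSpan_pointConfig hM
  ext p
  constructor
  · rintro ⟨_, ⟨x, hx, rfl⟩, y, hy, rfl⟩
    obtain ⟨f, hle, -, heq⟩ := exists_affineMap_of_covered (hx.of_refines hy)
    exact ⟨_, fun j => proj_evalConfig_mem hM (f j), congrArg _ (eq_tropSum_of_covered hle heq)⟩
  · rintro ⟨y, hy, rfl⟩
    choose f hf using fun j => exists_evalConfig_eq hM (hy j)
    refine ⟨_, ⟨tropSum y, covered_of_supports hv (f := f) (fun j i => ?_) (fun i => ?_), rfl⟩,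
      proj_mem_cell_self _ _⟩
    · rw [← evalConfig_apply, hf]
      exact Finset.inf'_le _ (Finset.mem_univ j)
    · obtain ⟨j, -, hj⟩ := Finset.exists_mem_eq_inf' Finset.univ_nonempty (fun j => y j i)
      refine ⟨j, ?_⟩
      rw [← evalConfig_apply, hf]
      exact hj

/-! ### Dimension of the cells -/

/-- Nearby height vectors induce finer subdivisions. -/
theorem eventually_refines (v : Fin (n + 1) → Fin d → ℝ) (x : Fin (n + 1) → ℝ) :
    ∀ᶠ y in nhds x, Refines (regularSubdivision v y) (regularSubdivision v x) := by
  -- For each of the finitely many spanning `G`, being supported is a closed condition on the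
  -- heights, so if it fails at `x` it fails nearby.
  have key : ∀ᶠ y in nhds x, ∀ G : Set (Fin (n + 1)), affineSpan ℝ (v '' G) = ⊤ →
      Supports v y G → Supports v x G := by
    rw [Filter.eventually_all]
    intro G
    by_cases hG : affineSpan ℝ (v '' G) = ⊤
    · by_cases hx : Supports v x G
      · exact Filter.Eventually.of_forall fun y _ _ => hx
      · have hcont : ∀ i, Continuous (slack v G i) := fun i =>
          LinearMap.continuous_of_finiteDimensional _
        have hcl : IsClosed {y | Supports v y G} := by
          simp only [supports_iff_slack hG, Set.ofPred_and, Set.ofPred_forall]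
          exact (isClosed_iInter fun i => isClosed_le continuous_const (hcont i)).inter
            (isClosed_iInter fun i => isClosed_iInter fun _ =>
              isClosed_eq (hcont i) continuous_const)
        filter_upwards [hcl.isOpen_compl.mem_nhds hx] with y hy _ hy'
        exact absurd hy' hy
    · exact Filter.Eventually.of_forall fun y h => absurd h hG
  filter_upwards [key] with y hy F hF
  exact (supports_iff_facet hF.1).1 (hy F hF.1 ((supports_iff_facet hF.1).2 ⟨F, hF, subset_rfl⟩))

/-- Evaluation of a pair of affine functionals, the first one on the points with label in `A` and
the second one on the other points. -/
def splitEval (v : Fin (n + 1) → Fin d → ℝ) (A : Finset (Fin (n + 1))) :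
    (((Fin d → ℝ) →ᵃ[ℝ] ℝ) × ((Fin d → ℝ) →ᵃ[ℝ] ℝ)) →ₗ[ℝ] (Fin (n + 1) → ℝ) where
  toFun f i := if i ∈ A then f.1 (v i) else f.2 (v i)
  map_add' f g := by
    ext i
    by_cases h : i ∈ A <;> simp [h]
  map_smul' c f := by
    ext i
    by_cases h : i ∈ A <;> simp [h]

theorem splitEval_of_mem (v : Fin (n + 1) → Fin d → ℝ) {A : Finset (Fin (n + 1))}
    (f : ((Fin d → ℝ) →ᵃ[ℝ] ℝ) × ((Fin d → ℝ) →ᵃ[ℝ] ℝ)) {i : Fin (n + 1)} (h : i ∈ A) :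
    splitEval v A f i = f.1 (v i) := if_pos h

theorem splitEval_of_notMem (v : Fin (n + 1) → Fin d → ℝ) {A : Finset (Fin (n + 1))}
    (f : ((Fin d → ℝ) →ᵃ[ℝ] ℝ) × ((Fin d → ℝ) →ᵃ[ℝ] ℝ)) {i : Fin (n + 1)} (h : i ∉ A) :
    splitEval v A f i = f.2 (v i) := if_neg h

theorem finrank_range_splitEval_le (v : Fin (n + 1) → Fin d → ℝ) (A : Finset (Fin (n + 1))) :
    Module.finrank ℝ (LinearMap.range (splitEval v A)) ≤ min (n + 1) (2 * (d + 1)) := by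
  refine le_min ?_ ?_
  · simpa using Submodule.finrank_le (LinearMap.range (splitEval v A))
  · refine (LinearMap.finrank_range_le _).trans ?_
    simp [AffineMap.finrank_eq, two_mul]

/-- If both parts are large, each determines its functional and the map is injective; if both are
small, arbitrary heights can be interpolated on each and it is surjective. -/
theorem le_finrank_range_splitEval {v : Fin (n + 1) → Fin d → ℝ} (hgen : InGeneralPosition v)
    (hd : d ≤ n) {A : Finset (Fin (n + 1))}
    (hA : (d + 1 ≤ A.card ∧ d + 1 ≤ Aᶜ.card) ∨ (A.card ≤ d + 1 ∧ Aᶜ.card ≤ d + 1)) :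
    min (n + 1) (2 * (d + 1)) ≤ Module.finrank ℝ (LinearMap.range (splitEval v A)) := by
  rcases hA with ⟨h1, h2⟩ | ⟨h1, h2⟩
  · refine (min_le_right _ _).trans ?_
    rw [LinearMap.finrank_range_of_inj]
    · simp [AffineMap.finrank_eq, two_mul]
    · intro f g hfg
      refine Prod.ext (affineMap_ext_of_span (span_of_card hgen h1) fun i hi => ?_)
        (affineMap_ext_of_span (span_of_card hgen h2) fun i hi => ?_)
      · rw [← splitEval_of_mem v f hi, hfg, splitEval_of_mem v g hi]
      · have hi' : i ∉ A := by simpa using hi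
        rw [← splitEval_of_notMem v f hi', hfg, splitEval_of_notMem v g hi']
  · refine (min_le_left _ _).trans ?_
    rw [LinearMap.range_eq_top.2, finrank_top]
    · simp
    · intro y
      obtain ⟨f, hf⟩ := exists_interpolation hgen hd h1 y
      obtain ⟨g, hg⟩ := exists_interpolation hgen hd h2 y
      refine ⟨(f, g), ?_⟩
      ext i
      by_cases hi : i ∈ A
      · rw [splitEval_of_mem v _ hi, hf i hi]
      · rw [splitEval_of_notMem v _ hi, hg i (by simpa using hi)]

theorem finrank_map_proj {W : Submodule ℝ (Fin (n + 1) → ℝ)} (hW : 1 ∈ W) :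
    Module.finrank ℝ (W.map (proj n)) + 1 = Module.finrank ℝ W := by
  have h := LinearMap.finrank_range_add_finrank_ker ((proj n).domRestrict W)
  have hker : LinearMap.ker ((proj n).domRestrict W) = Submodule.span ℝ {⟨1, hW⟩} := by
    ext ⟨y, hy⟩
    simp only [LinearMap.mem_ker, LinearMap.domRestrict_apply, Submodule.mkQ_apply,
      Submodule.Quotient.mk_eq_zero, Submodule.mem_span_singleton, Subtype.ext_iff,
      SetLike.mk_smul_mk]
  rw [hker, LinearMap.range_domRestrict, finrank_span_singleton (by
    intro h
    simpa using congrFun (congrArg Subtype.val h) 0)] at h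
  exact h

theorem one_mem_range_splitEval (v : Fin (n + 1) → Fin d → ℝ) (A : Finset (Fin (n + 1))) :
    (1 : Fin (n + 1) → ℝ) ∈ LinearMap.range (splitEval v A) :=
  ⟨(AffineMap.const ℝ _ 1, AffineMap.const ℝ _ 1), by
    ext i
    by_cases h : i ∈ A
    · rw [splitEval_of_mem v _ h]; rfl
    · rw [splitEval_of_notMem v _ h]; rfl⟩

/-- The `+ 1` accounts for the line spanned by `1`, which `proj` collapses. -/
theorem cellDim_cell_le {v : Fin (n + 1) → Fin d → ℝ} {S : Set (Set (Fin (n + 1)))}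
    {W : Submodule ℝ (Fin (n + 1) → ℝ)} (hW : 1 ∈ W)
    (h : ∀ y, Refines S (regularSubdivision v y) → y ∈ W) :
    cellDim (cell v S) + 1 ≤ Module.finrank ℝ W := by
  rw [← finrank_map_proj hW]
  refine Nat.add_le_add_right (Submodule.finrank_mono ?_) 1
  rw [vectorSpan_def, Submodule.span_le]
  rintro _ ⟨_, ⟨y, hy, rfl⟩, _, ⟨z, hz, rfl⟩, rfl⟩
  exact ⟨y - z, W.sub_mem (h y hy) (h z hz), map_sub _ _ _⟩

theorem le_cellDim_cell {v : Fin (n + 1) → Fin d → ℝ} {z : Fin (n + 1) → ℝ}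
    {W : Submodule ℝ (Fin (n + 1) → ℝ)} (hW : 1 ∈ W)
    (h : W ≤ Submodule.span ℝ {y | Refines (regularSubdivision v z) (regularSubdivision v y)}) :
    Module.finrank ℝ W ≤ cellDim (cell v (regularSubdivision v z)) + 1 := by
  rw [← finrank_map_proj hW]
  refine Nat.add_le_add_right (Submodule.finrank_mono ?_) 1
  -- The cell contains the origin, so its direction space is its linear span.
  have h0 : (0 : TP n) ∈ cell v (regularSubdivision v z) :=
    ⟨0, refines_iff_supports.2 fun F _ => ⟨0, by simp, by simp⟩, map_zero _⟩
  rw [vectorSpan_eq_span_vsub_set_right ℝ h0]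
  simp only [vsub_eq_sub, sub_zero, Set.image_id']
  refine (Submodule.map_mono h).trans ?_
  rw [Submodule.map_span]
  rfl

/-- Every height vector in the cell is still affine on each of the two covering facets; taking `A`
to be the first one, the labels off `A` belong to the second. -/
theorem cellDim_le_of_covered {v : Fin (n + 1) → Fin d → ℝ} {x : Fin (n + 1) → ℝ}
    (hx : CoveredByFacets 1 (regularSubdivision v x)) :
    cellDim (cell v (regularSubdivision v x)) + 1 ≤ min (n + 1) (2 * (d + 1)) := by
  classical
  obtain ⟨F, hF, hU⟩ := hx
  refine (cellDim_cell_le (one_mem_range_splitEval v (F 0).toFinset) fun y hy => ?_).trans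
    (finrank_range_splitEval_le v _)
  choose f hf hFf using fun j => refines_iff_supports.1 hy (F j) (hF j)
  refine ⟨(f 0, f 1), ?_⟩
  ext i
  by_cases hi : i ∈ (F 0).toFinset
  · rw [splitEval_of_mem v _ hi, hFf 0 i (by simpa using hi)]
  · rw [splitEval_of_notMem v _ hi, hFf 1 i]
    obtain ⟨j, hj⟩ := Set.mem_iUnion.1 (hU ▸ Set.mem_univ i)
    rw [Set.mem_toFinset] at hi
    fin_cases j
    exacts [absurd hj hi, hj]

theorem covered_splitEval {v : Fin (n + 1) → Fin d → ℝ}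
    (hv : affineSpan ℝ (v '' Set.univ) = ⊤) {A : Finset (Fin (n + 1))}
    (f : ((Fin d → ℝ) →ᵃ[ℝ] ℝ) × ((Fin d → ℝ) →ᵃ[ℝ] ℝ))
    (h1 : ∀ i ∈ A, f.1 (v i) ≤ f.2 (v i)) (h2 : ∀ i ∉ A, f.2 (v i) ≤ f.1 (v i)) :
    CoveredByFacets 1 (regularSubdivision v (splitEval v A f)) := by
  refine covered_of_supports hv (f := ![f.1, f.2]) (Fin.forall_fin_two.2 ⟨fun i => ?_, fun i => ?_⟩)
    fun i => ?_
  · by_cases hi : i ∈ A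
    · exact (splitEval_of_mem v f hi).le
    · exact (splitEval_of_notMem v f hi).trans_le (h2 i hi)
  · by_cases hi : i ∈ A
    · exact (splitEval_of_mem v f hi).trans_le (h1 i hi)
    · exact (splitEval_of_notMem v f hi).le
  · by_cases hi : i ∈ A
    · exact ⟨0, splitEval_of_mem v f hi⟩
    · exact ⟨1, splitEval_of_notMem v f hi⟩

/-- Close to the minimum of two affine functionals which differ on all of the points there is a
height vector of the same kind whose cell spans the space of all such height vectors. -/
theorem exists_cell_span {v : Fin (n + 1) → Fin d → ℝ}
    (hv : affineSpan ℝ (v '' Set.univ) = ⊤) {A : Finset (Fin (n + 1))}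
    (f : ((Fin d → ℝ) →ᵃ[ℝ] ℝ) × ((Fin d → ℝ) →ᵃ[ℝ] ℝ))
    (h1 : ∀ i ∈ A, f.1 (v i) < f.2 (v i)) (h2 : ∀ i ∉ A, f.2 (v i) < f.1 (v i))
    {P : (Fin (n + 1) → ℝ) → Prop} (hP : ∀ᶠ y in nhds (splitEval v A f), P y) :
    ∃ z, P z ∧ CoveredByFacets 1 (regularSubdivision v z) ∧ LinearMap.range (splitEval v A) ≤
      Submodule.span ℝ {y | Refines (regularSubdivision v z) (regularSubdivision v y)} := by
  let W := LinearMap.range (splitEval v A)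
  let U : Set (Set (Fin (n + 1))) → Submodule ℝ (Fin (n + 1) → ℝ) := fun S =>
    Submodule.span ℝ {y | Refines S (regularSubdivision v y)}
  -- Finitely many proper subspaces do not cover `W`: there is a direction in `W` outside every `U
  -- S` that does not contain `W`.
  obtain ⟨⟨_, ⟨b, rfl⟩⟩, hb⟩ := Submodule.exists_forall_notMem_of_forall_ne_top
    (fun S : {S // ¬ W ≤ U S} => (U S).comap W.subtype) fun S h =>
      S.2 (Submodule.comap_subtype_eq_top.1 h)
  have hsplit : ∀ t : ℝ, splitEval v A f + t • splitEval v A b = splitEval v A (f + t • b) :=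
    fun t => by rw [map_add, map_smul]
  have hcov : ∀ᶠ t : ℝ in nhds 0, CoveredByFacets 1
      (regularSubdivision v (splitEval v A f + t • splitEval v A b)) := by
    have hpos : ∀ᶠ t : ℝ in nhds 0, ∀ i,
        (i ∈ A → 0 < f.2 (v i) - f.1 (v i) + t * (b.2 (v i) - b.1 (v i))) ∧
        (i ∉ A → 0 < f.1 (v i) - f.2 (v i) + t * (b.1 (v i) - b.2 (v i))) := by
      rw [Filter.eventually_all]
      intro i
      by_cases hi : i ∈ A
      · filter_upwards [eventually_add_mul_pos (sub_pos.2 (h1 i hi)) _] with t ht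
        exact ⟨fun _ => ht, fun h => absurd hi h⟩
      · filter_upwards [eventually_add_mul_pos (sub_pos.2 (h2 i hi)) _] with t ht
        exact ⟨fun h => absurd h hi, fun _ => ht⟩
    filter_upwards [hpos] with t ht
    rw [hsplit]
    refine covered_splitEval hv _ (fun i hi => ?_) fun i hi => ?_
    · have := (ht i).1 hi
      simp only [Prod.fst_add, Prod.snd_add, Prod.smul_fst, Prod.smul_snd, AffineMap.coe_add,
        AffineMap.coe_smul, Pi.add_apply, Pi.smul_apply, smul_eq_mul]
      linarith
    · have := (ht i).2 hi
      simp only [Prod.fst_add, Prod.snd_add, Prod.smul_fst, Prod.smul_snd, AffineMap.coe_add,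
        AffineMap.coe_smul, Pi.add_apply, Pi.smul_apply, smul_eq_mul]
      linarith
  have hPt : ∀ᶠ t : ℝ in nhds 0, P (splitEval v A f + t • splitEval v A b) := by
    have hc : Continuous fun t : ℝ => splitEval v A f + t • splitEval v A b := by fun_prop
    refine (hc.tendsto 0).eventually ?_
    simpa using hP
  -- Infinitely many parameters but finitely many subdivisions: two share the same `S`. The
  -- difference of their height vectors is a nonzero multiple of the direction and lies in `U S`, so
  -- `U S` contains `W`.
  obtain ⟨t, ht, s, -, hts, heq⟩ := (infinite_of_mem_nhds _ (hcov.and hPt)).exists_ne_map_eq_of_mapsTo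
    (f := fun t : ℝ => regularSubdivision v (splitEval v A f + t • splitEval v A b))
    (Set.mapsTo_univ _ _) Set.finite_univ
  refine ⟨_, ht.2, ht.1, ?_⟩
  by_contra hS
  refine hb ⟨_, hS⟩ ?_
  have m1 : splitEval v A f + t • splitEval v A b ∈
      U (regularSubdivision v (splitEval v A f + t • splitEval v A b)) :=
    Submodule.subset_span (refines_refl _)
  have m2 : splitEval v A f + s • splitEval v A b ∈
      U (regularSubdivision v (splitEval v A f + t • splitEval v A b)) :=
    Submodule.subset_span (by rw [Set.mem_ofPred_eq, ← heq]; exact refines_refl _)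
  have m3 := Submodule.sub_mem _ m1 m2
  rw [add_sub_add_left_eq_sub, ← sub_smul] at m3
  exact (Submodule.smul_mem_iff _ (sub_ne_zero.2 hts)).1 m3

/-! ### Balanced splittings and maximal cells -/

theorem InGeneralPosition.injective {v : Fin (n + 1) → Fin d → ℝ} (hgen : InGeneralPosition v)
    (hd : d ≤ n) (hd0 : 0 < d) : Function.Injective v := by
  intro i j hij
  by_contra hne
  obtain ⟨s, hs, hcard⟩ := Finset.exists_superset_card_eq (s := {i, j}) (n := d + 1)
    (by rw [Finset.card_pair hne]; omega) (by simpa using hd)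
  have := (hgen s hcard).injective (a₁ := ⟨i, hs (by simp)⟩) (a₂ := ⟨j, hs (by simp)⟩) hij
  exact hne (congrArg Subtype.val this)

theorem exists_lower_set_card {ι : Type*} [Fintype ι] [DecidableEq ι] {u : ι → ℝ}
    (hu : Function.Injective u) :
    ∀ m ≤ Fintype.card ι, ∃ A : Finset ι, A.card = m ∧ ∀ i ∈ A, ∀ j ∉ A, u i < u j := by
  intro m
  induction m with
  | zero => exact fun _ => ⟨∅, rfl, by simp⟩
  | succ m ih =>
    intro hm
    obtain ⟨A, hA, hlt⟩ := ih (by omega)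
    have hne : Aᶜ.Nonempty := by
      rw [← Finset.card_pos, Finset.card_compl]
      omega
    obtain ⟨k, hk, hmin⟩ := Aᶜ.exists_min_image u hne
    rw [Finset.mem_compl] at hk
    refine ⟨insert k A, by rw [Finset.card_insert_of_notMem hk, hA], fun i hi j hj => ?_⟩
    rw [Finset.mem_insert, not_or] at hj
    rcases Finset.mem_insert.1 hi with rfl | hi
    · exact lt_of_le_of_ne (hmin j (by simpa using hj.2)) (hu.ne (Ne.symm hj.1))
    · exact hlt i hi j hj.2

/-- A hyperplane avoiding all of the points and having a prescribed number of them on one side. -/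
theorem exists_separating_affineMap {v : Fin (n + 1) → Fin d → ℝ} (hv : Function.Injective v)
    {m : ℕ} (hm0 : 0 < m) (hm : m ≤ n + 1) :
    ∃ (A : Finset (Fin (n + 1))) (g : (Fin d → ℝ) →ᵃ[ℝ] ℝ), A.card = m ∧
      (∀ i ∈ A, g (v i) < 0) ∧ ∀ i ∉ A, 0 < g (v i) := by
  -- A linear functional that is nonzero on all differences orders the points strictly; the
  -- hyperplane is a level set just above the `m` lowest ones.
  obtain ⟨l, hl⟩ := Module.exists_dual_forall_apply_ne_zero (K := ℝ)
    (fun p : {p : Fin (n + 1) × Fin (n + 1) // p.1 ≠ p.2} => v p.1.1 - v p.1.2)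
    fun p => sub_ne_zero.2 (hv.ne p.2)
  have hu : Function.Injective fun i => l (v i) := by
    intro i j hij
    by_contra hne
    exact hl ⟨(i, j), hne⟩ (by simpa [sub_eq_zero] using hij)
  obtain ⟨A, hA, hlt⟩ := exists_lower_set_card hu m (by simpa using hm)
  obtain ⟨k, hk, hmax⟩ := A.exists_max_image (fun i => l (v i)) (Finset.card_pos.1 (by omega))
  have hev : ∀ᶠ t : ℝ in nhdsWithin 0 (Set.Ioi 0), ∀ j, j ∉ A →
      0 < l (v j) - l (v k) + t * (-1) := by
    rw [Filter.eventually_all]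
    intro j
    by_cases hj : j ∈ A
    · exact Filter.Eventually.of_forall fun t h => absurd hj h
    · filter_upwards [nhdsWithin_le_nhds (eventually_add_mul_pos (sub_pos.2 (hlt k hk j hj)) (-1))]
        with t ht _ using ht
  obtain ⟨t, ht, ht0⟩ := (hev.and self_mem_nhdsWithin).exists
  have ht0 : 0 < t := ht0
  let g : (Fin d → ℝ) →ᵃ[ℝ] ℝ := l.toAffineMap - AffineMap.const ℝ _ (l (v k) + t)
  have hval : ∀ p, g p = l p - (l (v k) + t) := fun p => by simp [g]
  refine ⟨A, g, hA, fun i hi => ?_,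
    fun i hi => ?_⟩
  · rw [hval]
    linarith [hmax i hi]
  · rw [hval]
    linarith [ht i hi]

theorem supports_evalConfig (v : Fin (n + 1) → Fin d → ℝ) (f : (Fin d → ℝ) →ᵃ[ℝ] ℝ)
    (G : Set (Fin (n + 1))) : Supports v (evalConfig v f) G :=
  ⟨f, fun _ => le_rfl, fun _ _ => rfl⟩

theorem refines_evalConfig (v : Fin (n + 1) → Fin d → ℝ) (y : Fin (n + 1) → ℝ)
    (f : (Fin d → ℝ) →ᵃ[ℝ] ℝ) :
    Refines (regularSubdivision v y) (regularSubdivision v (evalConfig v f)) :=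
  refines_iff_supports.2 fun F _ => supports_evalConfig v f F

theorem exists_evalConfig_eq_of_covered_of_dim_zero {v : Fin (n + 1) → Fin 0 → ℝ} {k : ℕ}
    {x : Fin (n + 1) → ℝ} (hx : CoveredByFacets k (regularSubdivision v x)) :
    ∃ f, evalConfig v f = x := by
  obtain ⟨f, hle, hs, heq⟩ := exists_affineMap_of_covered hx
  refine ⟨f 0, ?_⟩
  ext i
  refine le_antisymm ?_ (hle 0 i)
  obtain ⟨j, hj⟩ := heq i
  obtain ⟨i', hi'⟩ := span_nonempty (hs 0)
  rw [Set.mem_ofPred_eq] at hi'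
  rw [evalConfig_apply, Subsingleton.elim (v i) (v i'), ← hi', hj, Subsingleton.elim (v i) (v i')]
  exact hle j i'

/-- The general bound `min (n + 1) (2 * (d + 1))` is not sharp for `d = 0` and `n ≥ 1`: coinciding
points cannot be separated, and valid heights are constant. -/
theorem cellDim_eq_zero_of_dim_zero {v : Fin (n + 1) → Fin 0 → ℝ} {k : ℕ}
    {x : Fin (n + 1) → ℝ} (hx : CoveredByFacets k (regularSubdivision v x)) :
    cellDim (cell v (regularSubdivision v x)) = 0 := by
  have h1 := cellDim_cell_le (v := v) (S := regularSubdivision v x)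
    (W := LinearMap.range (evalConfig v)) ⟨_, (one_eq_evalConfig v).symm⟩
    fun y hy => exists_evalConfig_eq_of_covered_of_dim_zero (hx.of_refines hy)
  have h2 := h1.trans (LinearMap.finrank_range_le _)
  simpa [AffineMap.finrank_eq] using h2

/-- Near a height vector of the first secant variety there are pairs of affine functionals which
differ on all of the points and split them in a balanced way. -/
theorem exists_balanced_splitEval {v : Fin (n + 1) → Fin d → ℝ}
    (hgen : InGeneralPosition v) (hd : d ≤ n) (hd0 : 0 < d) {x : Fin (n + 1) → ℝ}
    (hx : CoveredByFacets 1 (regularSubdivision v x)) :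
    ∃ (A : Finset (Fin (n + 1))) (f : ((Fin d → ℝ) →ᵃ[ℝ] ℝ) × ((Fin d → ℝ) →ᵃ[ℝ] ℝ)),
      ((d + 1 ≤ A.card ∧ d + 1 ≤ Aᶜ.card) ∨ (A.card ≤ d + 1 ∧ Aᶜ.card ≤ d + 1)) ∧
      (∀ i ∈ A, f.1 (v i) < f.2 (v i)) ∧ (∀ i ∉ A, f.2 (v i) < f.1 (v i)) ∧
      ∀ᶠ y in nhds (splitEval v A f), Refines (regularSubdivision v y) (regularSubdivision v x) := by
  classical
  obtain ⟨f, hle, hs, heq⟩ := exists_affineMap_of_covered hx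
  rw [Fin.forall_fin_two] at hle hs
  replace heq := fun i => Fin.exists_fin_two.1 (heq i)
  by_cases hf : f 0 = f 1
  · have hxf : x = evalConfig v (f 0) := by
      ext i
      rcases heq i with h | h
      · exact h
      · rw [h, hf, evalConfig_apply]
    -- Affine heights are refined by every subdivision, so any balanced separation will do. A side
    -- with exactly `d + 1` labels is balanced whatever the size of the other.
    obtain ⟨A, g, hA, h1, h2⟩ := exists_separating_affineMap (hgen.injective hd hd0)
      (Nat.succ_pos d) (Nat.succ_le_succ hd)
    refine ⟨A, (g, 0), ?_, h1, h2, Filter.Eventually.of_forall fun y => ?_⟩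
    · rw [Finset.card_compl, Fintype.card_fin]
      omega
    · rw [hxf]
      exact refines_evalConfig v y _
  let S : Fin 2 → Finset (Fin (n + 1)) := fun j => Finset.univ.filter fun i => x i = f j (v i)
  have hS : ∀ j i, i ∈ S j ↔ x i = f j (v i) := fun j i => Finset.mem_filter_univ i
  have hcoe : ∀ j, (S j : Set (Fin (n + 1))) = {i | x i = f j (v i)} := fun j => by
    ext i
    exact hS j i
  have hc0 : d + 1 ≤ (S 0).card := card_le_of_span (v := v) (by rw [hcoe]; exact hs.1)
  have hc1 : d + 1 ≤ (S 1).card := card_le_of_span (v := v) (by rw [hcoe]; exact hs.2)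
  have hZ : (S 0 ∩ S 1).card ≤ d + 1 := by
    by_contra! h
    refine hf (affineMap_ext_of_span (span_of_card hgen h.le) fun i hi => ?_)
    rw [Finset.mem_coe, Finset.mem_inter, hS, hS] at hi
    rw [← hi.1, hi.2]
  have hcompl : (S 1)ᶜ ⊆ S 0 := fun i hi => by
    rw [Finset.mem_compl, hS] at hi
    exact (hS 0 i).2 ((heq i).resolve_right hi)
  -- The labels tight for both functionals may go to either side. The size `max (d + 1) (S 1)ᶜ.card`
  -- is balanced: either `A` has `d + 1` elements, or it is `(S 1)ᶜ`, whose complement `S 1` has at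
  -- least `d + 1`.
  obtain ⟨A, hsA, hAs, hA⟩ := Finset.exists_subsuperset_card_eq hcompl
    (le_max_right (d + 1) _) (max_le hc0 (Finset.card_le_card hcompl))
  have hS1 : ∀ i, i ∉ A → x i = f 1 (v i) := fun i hi => by
    by_contra h
    exact hi (hsA (by rwa [Finset.mem_compl, hS]))
  have hS0 : ∀ i ∈ A, x i = f 0 (v i) := fun i hi => (hS 0 i).1 (hAs hi)
  -- There are few enough common labels to prescribe a perturbation of `f 0` there, pushing it below
  -- `f 1` on `A` and above it elsewhere. At the other labels the strict inequality survives a small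
  -- perturbation.
  obtain ⟨a, ha⟩ := exists_interpolation hgen hd hZ fun i => if i ∈ A then -1 else 1
  have hxs : x = splitEval v A (f 0, f 1) := by
    ext i
    by_cases hi : i ∈ A
    · rw [splitEval_of_mem v _ hi, hS0 i hi]
    · rw [splitEval_of_notMem v _ hi, hS1 i hi]
  have hev : ∀ᶠ t : ℝ in nhds 0, ∀ᶠ y in nhds (splitEval v A ((f 0, f 1) + t • (a, 0))),
      Refines (regularSubdivision v y) (regularSubdivision v x) := by
    have hc : Continuous fun t : ℝ => splitEval v A ((f 0, f 1) + t • (a, 0)) := by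
      simp only [map_add, map_smul]
      fun_prop
    exact (hc.tendsto' 0 x (by rw [zero_smul, add_zero, ← hxs])).eventually
      (eventually_refines v x).eventually_nhds
  have hpos : ∀ᶠ t : ℝ in nhdsWithin 0 (Set.Ioi 0), ∀ i,
      (i ∈ A → (f 0 + t • a) (v i) < f 1 (v i)) ∧
      (i ∉ A → f 1 (v i) < (f 0 + t • a) (v i)) := by
    have hval : ∀ (t : ℝ) i, (f 0 + t • a) (v i) = f 0 (v i) + t * a (v i) := fun t i => rfl
    simp only [hval]
    rw [Filter.eventually_all]
    intro i
    by_cases hz : f 0 (v i) = f 1 (v i)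
    · have hai := ha i (by
        rw [Finset.mem_inter, hS, hS, hz, and_self]
        rcases heq i with h | h
        exacts [h.trans hz, h])
      filter_upwards [self_mem_nhdsWithin] with t ht
      have ht : 0 < t := ht
      by_cases hi : i ∈ A
      · refine ⟨fun _ => ?_, fun h => absurd hi h⟩
        rw [hai, if_pos hi]
        linarith
      · refine ⟨fun h => absurd h hi, fun _ => ?_⟩
        rw [hai, if_neg hi]
        linarith
    · by_cases hi : i ∈ A
      · have hlt : f 0 (v i) < f 1 (v i) :=
          lt_of_le_of_ne ((hS0 i hi).symm.trans_le (hle.2 i)) hz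
        filter_upwards [nhdsWithin_le_nhds (eventually_add_mul_pos (sub_pos.2 hlt) (-a (v i)))]
          with t ht
        exact ⟨fun _ => by linarith, fun h => absurd hi h⟩
      · have hlt : f 1 (v i) < f 0 (v i) :=
          lt_of_le_of_ne ((hS1 i hi).symm.trans_le (hle.1 i)) (Ne.symm hz)
        filter_upwards [nhdsWithin_le_nhds (eventually_add_mul_pos (sub_pos.2 hlt) (a (v i)))]
          with t ht
        exact ⟨fun h => absurd h hi, fun _ => by linarith⟩
  obtain ⟨t, ht, ht'⟩ := ((hev.filter_mono nhdsWithin_le_nhds).and hpos).exists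
  refine ⟨A, (f 0, f 1) + t • (a, 0), ?_, fun i hi => ?_, fun i hi => ?_, ht⟩
  · have := Finset.card_compl_add_card (S 1)
    rw [Fintype.card_fin] at this
    rw [Finset.card_compl, Fintype.card_fin]
    omega
  · simpa using (ht' i).1 hi
  · simpa using (ht' i).2 hi

theorem exists_refines_of_maximal_cellDim {v : Fin (n + 1) → Fin d → ℝ}
    (hv : affineSpan ℝ (v '' Set.univ) = ⊤) (hgen : InGeneralPosition v) {x : Fin (n + 1) → ℝ}
    (hx : CoveredByFacets 1 (regularSubdivision v x)) :
    ∃ z, CoveredByFacets 1 (regularSubdivision v z) ∧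
      Refines (regularSubdivision v z) (regularSubdivision v x) ∧
      ∀ B ∈ secantCells 1 v, cellDim B ≤ cellDim (cell v (regularSubdivision v z)) := by
  rcases Nat.eq_zero_or_pos d with rfl | hd0
  · refine ⟨x, hx, refines_refl _, ?_⟩
    rintro _ ⟨y, hy, rfl⟩
    rw [cellDim_eq_zero_of_dim_zero hy]
    exact Nat.zero_le _
  · obtain ⟨A, f, hA, h1, h2, hev⟩ := exists_balanced_splitEval hgen (dim_le hv) hd0 hx
    obtain ⟨z, hzx, hz, hspan⟩ := exists_cell_span hv f h1 h2 hev
    refine ⟨z, hz, hzx, ?_⟩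
    rintro _ ⟨y, hy, rfl⟩
    -- Upper bound for any valid cell and lower bound for the constructed one meet at `min (n + 1)
    -- (2 * (d + 1))`.
    have := (cellDim_le_of_covered hy).trans ((le_finrank_range_splitEval hgen (dim_le hv) hA).trans
      (le_cellDim_cell (one_mem_range_splitEval v A) hspan))
    omega

end TropSecant

theorem proposition2p5 (n d : ℕ) (L : Submodule ℝ (TropSecant.TP n))
    (M : Matrix (Fin d) (Fin (n + 1)) ℝ) (hM : TropSecant.IsAssociatedMatrix M L)
    (hgen : TropSecant.InGeneralPosition (TropSecant.pointConfig M)) :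
    TropSecant.IsPolyhedralComplex (TropSecant.secantCells 1 (TropSecant.pointConfig M)) ∧
    ⋃₀ TropSecant.secantCells 1 (TropSecant.pointConfig M) = TropSecant.secantVariety 1 L ∧
    TropSecant.IsPure (TropSecant.secantCells 1 (TropSecant.pointConfig M)) ∧
    (∀ x : Fin (n + 1) → ℝ,
      TropSecant.CoveredByFacets 1
        (TropSecant.regularSubdivision (TropSecant.pointConfig M) x) →
      ∃ z : Fin (n + 1) → ℝ,
        TropSecant.CoveredByFacets 1
          (TropSecant.regularSubdivision (TropSecant.pointConfig M) z) ∧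
        TropSecant.Refines (TropSecant.regularSubdivision (TropSecant.pointConfig M) z)
          (TropSecant.regularSubdivision (TropSecant.pointConfig M) x) ∧
        ∀ B ∈ TropSecant.secantCells 1 (TropSecant.pointConfig M),
          TropSecant.cellDim B ≤ TropSecant.cellDim (TropSecant.cell (TropSecant.pointConfig M)
            (TropSecant.regularSubdivision (TropSecant.pointConfig M) z))) := by
  have hv := TropSecant.affineSpan_pointConfig hM
  refine ⟨TropSecant.isPolyhedralComplex_secantCells hv 1, TropSecant.sUnion_secantCells hM 1, ?_,
    fun x hx => TropSecant.exists_refines_of_maximal_cellDim hv hgen hx⟩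
  rintro _ ⟨x, hx, rfl⟩
  obtain ⟨z, hz, hzx, hmax⟩ := TropSecant.exists_refines_of_maximal_cellDim hv hgen hx
  exact ⟨_, ⟨z, hz, rfl⟩, TropSecant.cell_subset_cell hzx, hmax⟩
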